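/- Let $U$ be an infinite set and $C$ an infinite set of subsets of $U$ (concepts); $F=(U,C)$ is an infinite family of concepts. For $u\in U$ and $c\in C$ let $u(c)=1$ if $u\in c$ and $u(c)=0$ otherwise. A problem over $F$ of dimension $n\ge 1$ is a tuple $z=(u_1,\dots,u_n)\in U^n$: for a hidden $c\in C$ one has to find $z(c)=(u_1(c),\dots,u_n(c))$. A decision tree over $z$ is a finite rooted tree. Each terminal node is labeled with a tuple from $\{0,1\}^n$. Each other (working) node is labeled either with a membership query "$u_i(x)=?$", with two outgoing edges labeled $\{u_i(x)=0\}$ and $\{u_i(x)=1\}$, or with an equivalence query about an arbitrary hypothesis $H=\{u_1(x)=\delta_1,\dots,u_n(x)=\delta_n\}$, $\delta_i\in\{0,1\}$, with $n+1$ outgoing edges labeled $H,\{u_1(x)=\lnot\delta_1\},\dots,\{u_n(x)=\lnot\delta_n\}$. The tree solves $z$ if, for each $c\in C$ and each path from the root to a terminal node such that $c$ satisfies all equations on the edges of the path, the terminal node is labeled with $z(c)$. The depth of a tree is the maximum number of working nodes on a path from the root to a terminal node. Let $h_F^{(2)}(z)$ be the minimum depth of a decision tree over $z$ that solves $z$ and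 uses only equivalence queries, and $h_F^{(3)}(z)$ the minimum depth of a decision tree over $z$ that solves $z$ and may use both membership and equivalence queries. For $i\in\{2,3\}$ and $n\ge 1$ let $h_F^{(i)}(n)=\max h_F^{(i)}(z)$ over all problems $z$ over $F$ of dimension at most $n$. For $u\in U$, $\delta\in\{0,1\}$ and $D\subseteq C$ let $D(u,\delta)=\{c\in D:u(c)=\delta\}$. The pair $(U,D)$ is a $0$-family if every $u\in U$ is constant on $D$ (in particular if $D=\emptyset$). For $k\ge 0$ it is a $(k+1)$-family if it is not an $m$-family for any $m\in\{0,\dots,k\}$ and, for every $u\in U$, there are $\delta\in\{0,1\}$ and $m\in\{0,\dots,k\}$ such that $(U,D(u,\delta))$ is an $m$-family. Let $\mathcal C$ be the class of infinite families of concepts that are $k$-families for some $k\ge 1$, and $\mathcal D$ the class of infinite families of concepts with finite VC-dimension (the largest cardinality of a finite $A\subseteq U$ such that every subset of $A$ has the form $A\cap c$ with $c\in C$; infinite if there is no largest one). Theorem 2. Let $F$ be an infinite family of concepts. Then: (a) If $F\in\mathcal C$, then $h_F^{(2)}(n)=O(1)$ and $h_F^{(3)}(n)=O(1)$. (b) If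 $F\in\mathcal D\setminus\mathcal C$, then $h_F^{(2)}(n)=\Theta(\log n)$, $h_F^{(3)}(n)=\Omega\!\left(\frac{\log n}{\log\log n}\right)$, and $h_F^{(3)}(n)=O(\log n)$. (c) If $F\notin\mathcal D$, then $h_F^{(2)}(n)=n$ and $h_F^{(3)}(n)=n$ for every $n\ge 1$. -/

import Mathlib

open Filter Asymptotics

namespace ExactLearning

/-! A family of concepts `(U, C)` is a type `U` of elements and a set `C : Set (Set U)` of
concepts. Truth values `0`, `1` are `false`, `true`. -/

section Families

variable {U : Type*}

open Classical in
/-- The function `u : C → {0,1}` given by an element `u`: `u(c) = 1` iff `u ∈ c`. -/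
noncomputable def value (u : U) (c : Set U) : Bool := decide (u ∈ c)

/-- `C(u, δ) = {c ∈ C : u(c) = δ}`. -/
def restrict (C : Set (Set U)) (u : U) (δ : Bool) : Set (Set U) :=
  {c | c ∈ C ∧ value u c = δ}

/-- `(U, C)` is a `k`-family of concepts. A set of concepts that is empty is a `0`-family, since
every function is constant on it. -/
def IsKFamily (k : ℕ) (C : Set (Set U)) : Prop :=
  match k with
  | 0 => ∀ u : U, ∃ δ : Bool, ∀ c ∈ C, value u c = δ
  | k + 1 =>
      (∀ m : Fin (k + 1), ¬ IsKFamily m.val C) ∧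
        ∀ u : U, ∃ δ : Bool, ∃ m : Fin (k + 1), IsKFamily m.val (restrict C u δ)
termination_by k
decreasing_by all_goals exact m.isLt

/-- The class of families that are `k`-families for some positive natural `k`. -/
def InClassC (C : Set (Set U)) : Prop := ∃ k : ℕ, 1 ≤ k ∧ IsKFamily k C

/-- The finite set `A` of elements is shattered by `C`. -/
def Shattered (C : Set (Set U)) (A : Finset U) : Prop :=
  ∀ X : Set U, X ⊆ (A : Set U) → ∃ c ∈ C, (A : Set U) ∩ c = X

/-- The Vapnik-Chervonenkis dimension of `(U, C)`, with value `⊤` for infinite dimension. -/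
noncomputable def vcDim (C : Set (Set U)) : ℕ∞ :=
  ⨆ A : {A : Finset U // Shattered C A}, (A.val.card : ℕ∞)

/-- The class of families with finite VC-dimension. -/
def InClassD (C : Set (Set U)) : Prop := vcDim C < ⊤

/-- The concept `c` is a solution of the system of equations `S`, in which the pair `(u, δ)`
stands for the equation `u(x) = δ`. -/
def IsSolution (S : Set (U × Bool)) (c : Set U) : Prop := ∀ e ∈ S, value e.1 c = e.2

end Families

/-- Decision trees over a problem `(u_1, …, u_n)`. A working node is labeled with a membership
query (about `u_i`), and has one child for each of the two answers, or with an equivalence query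
(about the hypothesis `u_1(x) = δ_1, …, u_n(x) = δ_n`), and then has one child `yes` for the
confirmation and one child `no i` for each counterexample `u_i(x) = ¬ δ_i`. -/
inductive DecisionTree (n : ℕ) : Type
  | terminal (σ : Fin n → Bool) : DecisionTree n
  | membership (i : Fin n) (child : Bool → DecisionTree n) : DecisionTree n
  | equivalence (δ : Fin n → Bool) (yes : DecisionTree n) (no : Fin n → DecisionTree n) :
      DecisionTree n

namespace DecisionTree

variable {U : Type*} {n : ℕ}

/-- The maximum number of working nodes in a complete path. -/
def depth : DecisionTree n → ℕ
  | terminal _ => 0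
  | membership _ child => max (child false).depth (child true).depth + 1
  | equivalence _ yes no => max yes.depth (Finset.univ.sup fun i => (no i).depth) + 1

/-- All queries in the tree are equivalence queries. -/
def OnlyEquivalence : DecisionTree n → Prop
  | terminal _ => True
  | membership _ _ => False
  | equivalence _ yes no => yes.OnlyEquivalence ∧ ∀ i, (no i).OnlyEquivalence

/-- `CompletePath z Γ S σ`: the tree `Γ` over the problem `z` has a complete path whose edges are
labeled with systems of equations with union `S` and whose terminal node is labeled with `σ`. -/
inductive CompletePath (z : Fin n → U) :
    DecisionTree n → Set (U × Bool) → (Fin n → Bool) → Prop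
  | terminal (σ : Fin n → Bool) : CompletePath z (terminal σ) ∅ σ
  | membership (i : Fin n) (child : Bool → DecisionTree n) (b : Bool)
      (S : Set (U × Bool)) (σ : Fin n → Bool) (h : CompletePath z (child b) S σ) :
      CompletePath z (membership i child) ({(z i, b)} ∪ S) σ
  | yes (δ : Fin n → Bool) (yes : DecisionTree n) (no : Fin n → DecisionTree n)
      (S : Set (U × Bool)) (σ : Fin n → Bool) (h : CompletePath z yes S σ) :
      CompletePath z (equivalence δ yes no) (Set.range (fun i => (z i, δ i)) ∪ S) σ
  | no (δ : Fin n → Bool) (yes : DecisionTree n) (no : Fin n → DecisionTree n) (i : Fin n)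
      (S : Set (U × Bool)) (σ : Fin n → Bool) (h : CompletePath z (no i) S σ) :
      CompletePath z (equivalence δ yes no) ({(z i, !(δ i))} ∪ S) σ

/-- The tree `Γ` solves the problem `z` relative to `(U, C)`: for each concept `c` of `C`, every
complete path whose system of equations has the solution `c` ends in the label `z(c)`. -/
def Solves (Γ : DecisionTree n) (C : Set (Set U)) (z : Fin n → U) : Prop :=
  ∀ c ∈ C, ∀ S σ, CompletePath z Γ S σ → IsSolution S c → σ = fun i => value (z i) c

end DecisionTree

section Complexity

variable {U : Type*}

/-- The depths of the trees that solve `z` and use only equivalence queries. -/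
def depths2 (C : Set (Set U)) {n : ℕ} (z : Fin n → U) : Set ℕ :=
  {d | ∃ Γ : DecisionTree n, Γ.OnlyEquivalence ∧ Γ.Solves C z ∧ Γ.depth = d}

/-- The depths of the trees that solve `z` and may use both kinds of queries. -/
def depths3 (C : Set (Set U)) {n : ℕ} (z : Fin n → U) : Set ℕ :=
  {d | ∃ Γ : DecisionTree n, Γ.Solves C z ∧ Γ.depth = d}

/-- `h^{(2)}` of a problem: a minimum, see `isLeast_hProblem2`. -/
noncomputable def hProblem2 (C : Set (Set U)) {n : ℕ} (z : Fin n → U) : ℕ := sInf (depths2 C z)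

/-- `h^{(3)}` of a problem: a minimum, see `isLeast_hProblem3`. -/
noncomputable def hProblem3 (C : Set (Set U)) {n : ℕ} (z : Fin n → U) : ℕ := sInf (depths3 C z)

/-- The numbers `h^{(2)}(z)` for the problems `z` of positive dimension at most `n`. -/
def values2 (C : Set (Set U)) (n : ℕ) : Set ℕ :=
  {d | ∃ m : ℕ, 1 ≤ m ∧ m ≤ n ∧ ∃ z : Fin m → U, hProblem2 C z = d}

/-- The numbers `h^{(3)}(z)` for the problems `z` of positive dimension at most `n`. -/
def values3 (C : Set (Set U)) (n : ℕ) : Set ℕ :=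
  {d | ∃ m : ℕ, 1 ≤ m ∧ m ≤ n ∧ ∃ z : Fin m → U, hProblem3 C z = d}

/-- The function `h^{(2)}(n)`: a maximum, see `isGreatest_h2`. -/
noncomputable def h2 (C : Set (Set U)) (n : ℕ) : ℕ := sSup (values2 C n)

/-- The function `h^{(3)}(n)`: a maximum, see `isGreatest_h3`. -/
noncomputable def h3 (C : Set (Set U)) (n : ℕ) : ℕ := sSup (values3 C n)

/-! The minima and maxima above are attained. -/

theorem exists_tree_aux (C : Set (Set U)) {n : ℕ} (z : Fin n → U) (r : ℕ) :
    ∀ (K : Finset (Fin n)) (δ : Fin n → Bool), Kᶜ.card = r →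
      ∃ Γ : DecisionTree n, Γ.OnlyEquivalence ∧ Γ.depth ≤ r ∧
        Γ.Solves {c | c ∈ C ∧ ∀ i ∈ K, value (z i) c = δ i} z := by
  induction r with
  | zero =>
    intro K δ hK
    refine ⟨.terminal δ, trivial, le_rfl, ?_⟩
    intro c hc S σ hp _
    cases hp
    funext i
    refine (hc.2 i ?_).symm
    by_contra hi
    have : i ∈ Kᶜ := Finset.mem_compl.2 hi
    rw [Finset.card_eq_zero.1 hK] at this
    simp at this
  | succ r ih =>
    intro K δ hK
    have step : ∀ i : Fin n, ∃ Γ : DecisionTree n, Γ.OnlyEquivalence ∧ Γ.depth ≤ r ∧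
        Γ.Solves {c | c ∈ C ∧ (∀ j ∈ K, value (z j) c = δ j) ∧ value (z i) c = !(δ i)} z := by
      intro i
      by_cases hi : i ∈ K
      · refine ⟨.terminal δ, trivial, Nat.zero_le _, ?_⟩
        intro c hc
        exfalso
        have h1 := hc.2.1 i hi
        rw [hc.2.2] at h1
        simp at h1
      · have hcard : (insert i K)ᶜ.card = r := by
          rw [Finset.card_compl, Finset.card_insert_of_notMem hi]
          rw [Finset.card_compl] at hK
          omega
        obtain ⟨Γ, h1, h2, h3⟩ := ih (insert i K) (Function.update δ i (!(δ i))) hcard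
        refine ⟨Γ, h1, h2, fun c hc => h3 c ⟨hc.1, ?_⟩⟩
        intro j hj
        by_cases hji : j = i
        · subst hji
          simpa using hc.2.2
        · rw [Function.update_of_ne hji]
          exact hc.2.1 j ((Finset.mem_insert.1 hj).resolve_left hji)
    choose no hno using step
    refine ⟨.equivalence δ (.terminal δ) no, ⟨trivial, fun i => (hno i).1⟩, ?_, ?_⟩
    · simp only [DecisionTree.depth]
      have : (Finset.univ.sup fun i => (no i).depth) ≤ r :=
        Finset.sup_le fun i _ => (hno i).2.1
      omega
    · intro c hc S σ hp hS
      cases hp with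
      | yes _ _ _ S' _ h =>
        cases h
        funext i
        exact (hS (z i, δ i) (Or.inl ⟨i, rfl⟩)).symm
      | no _ _ _ i S' _ h =>
        exact (hno i).2.2 c ⟨hc.1, hc.2, hS (z i, !(δ i)) (Or.inl rfl)⟩ S' σ h
          fun e he => hS e (Or.inr he)

theorem exists_tree (C : Set (Set U)) {n : ℕ} (z : Fin n → U) :
    ∃ Γ : DecisionTree n, Γ.OnlyEquivalence ∧ Γ.Solves C z ∧ Γ.depth ≤ n := by
  obtain ⟨Γ, h1, h2, h3⟩ := exists_tree_aux C z n ∅ (fun _ => false) (by simp)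
  exact ⟨Γ, h1, fun c hc => h3 c ⟨hc, by simp⟩, h2⟩

theorem isLeast_hProblem2 (C : Set (Set U)) {n : ℕ} (z : Fin n → U) :
    IsLeast (depths2 C z) (hProblem2 C z) := by
  obtain ⟨Γ, h1, h2, -⟩ := exists_tree C z
  exact ⟨Nat.sInf_mem ⟨_, Γ, h1, h2, rfl⟩, fun _ hd => Nat.sInf_le hd⟩

theorem isLeast_hProblem3 (C : Set (Set U)) {n : ℕ} (z : Fin n → U) :
    IsLeast (depths3 C z) (hProblem3 C z) := by
  obtain ⟨Γ, -, h2, -⟩ := exists_tree C z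
  exact ⟨Nat.sInf_mem ⟨_, Γ, h2, rfl⟩, fun _ hd => Nat.sInf_le hd⟩

theorem isGreatest_h2 [Nonempty U] (C : Set (Set U)) {n : ℕ} (hn : 1 ≤ n) :
    IsGreatest (values2 C n) (h2 C n) := by
  have hb : BddAbove (values2 C n) := by
    refine ⟨n, ?_⟩
    rintro _ ⟨m, -, hm, z, rfl⟩
    obtain ⟨Γ, h1, h2, h3⟩ := exists_tree C z
    exact ((isLeast_hProblem2 C z).2 ⟨Γ, h1, h2, rfl⟩).trans (h3.trans hm)
  have hne : (values2 C n).Nonempty :=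
    ⟨_, 1, le_rfl, hn, fun _ => Classical.arbitrary U, rfl⟩
  exact ⟨Nat.sSup_mem hne hb, fun _ hd => le_csSup hb hd⟩

theorem isGreatest_h3 [Nonempty U] (C : Set (Set U)) {n : ℕ} (hn : 1 ≤ n) :
    IsGreatest (values3 C n) (h3 C n) := by
  have hb : BddAbove (values3 C n) := by
    refine ⟨n, ?_⟩
    rintro _ ⟨m, -, hm, z, rfl⟩
    obtain ⟨Γ, -, h2, h3⟩ := exists_tree C z
    exact ((isLeast_hProblem3 C z).2 ⟨Γ, h2, rfl⟩).trans (h3.trans hm)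
  have hne : (values3 C n).Nonempty :=
    ⟨_, 1, le_rfl, hn, fun _ => Classical.arbitrary U, rfl⟩
  exact ⟨Nat.sSup_mem hne hb, fun _ hd => le_csSup hb hd⟩

end Complexity

end ExactLearning

/-!
A family has a *mistake tree* of depth `t` if one can branch on elements `t` times, along a complete
binary tree, with a concept left at each of the `2 ^ t` leaves (`HasMistakeTree`). A family that is
not an `m`-family for any `m ≤ k` has a mistake tree of depth `k + 1`
(`exists_finset_hasMistakeTree`); so the number `k` of a `k`-family is a Littlestone dimension.

* For a `k`-family, the hypothesis that predicts, at each element, the answer that does *not*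
  lower `k` forces each counterexample to lower it, so `k` equivalence queries suffice
  (`IsKFamily.exists_tree_depth_le`).
* For finite VC-dimension `d`, the Sauer–Shelah lemma leaves at most `(d + 1) n ^ d` tuples `z(c)`.
  A counterexample to the majority vote halves their number, so `O(log n)` equivalence queries
  suffice (`exists_tree_depth_le_of_card_lt`).
* If there are mistake trees of each depth `t`, the fewer than `2 ^ t` elements that label one form a
  problem that needs `t` equivalence queries: the adversary walks down the tree, and refutes each
  hypothesis at the current node (`HasMistakeTree.le_depth`). This gives the bound `Ω(log n)`. If
  membership queries are allowed as well, one counts the leaves: a hypothesis picks out one branch,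
  and each leaf but one can be refuted at one of the `t` nodes of that branch; so a decision tree
  of depth `h` copes with at most `(t + 1) ^ h` leaves, and `2 ^ t ≤ (t + 1) ^ h`
  (`HasMistakeTree.two_pow_le`), which gives `Ω(log n / log log n)`.
* On a shattered set of `n` elements, an adversary can give answers that each fix one value only
  (`card_le_depth_add_card`), so `n` queries are needed. That `n` queries suffice holds for each
  family.
-/

namespace ExactLearning

variable {U : Type*}

/-! ### Queries and subfamilies -/

theorem restrict_subset (C : Set (Set U)) (u : U) (b : Bool) : restrict C u b ⊆ C :=
  fun _ hc => hc.1

namespace DecisionTree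

variable {n : ℕ} {C : Set (Set U)} {z : Fin n → U}

theorem Solves.mono {Γ : DecisionTree n} {D : Set (Set U)} (h : Γ.Solves C z) (hD : D ⊆ C) :
    Γ.Solves D z :=
  fun c hc => h c (hD hc)

theorem solves_terminal {σ : Fin n → Bool} :
    (terminal σ).Solves C z ↔ ∀ c ∈ C, σ = fun i => value (z i) c := by
  constructor
  · intro h c hc
    exact h c hc ∅ σ (.terminal σ) fun e he => he.elim
  · intro h c hc S σ' hp _
    cases hp
    exact h c hc

theorem Solves.membership_child {i : Fin n} {child : Bool → DecisionTree n}
    (h : (membership i child).Solves C z) (b : Bool) :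
    (child b).Solves (restrict C (z i) b) z := by
  intro c hc S σ hp hS
  refine h c hc.1 _ σ (.membership i child b S σ hp) ?_
  rintro e (rfl | he)
  · exact hc.2
  · exact hS e he

theorem Solves.equivalence_no {δ : Fin n → Bool} {yes : DecisionTree n}
    {no : Fin n → DecisionTree n} (h : (equivalence δ yes no).Solves C z) (i : Fin n) :
    (no i).Solves (restrict C (z i) (!(δ i))) z := by
  intro c hc S σ hp hS
  refine h c hc.1 _ σ (.no δ yes no i S σ hp) ?_
  rintro e (rfl | he)
  · exact hc.2
  · exact hS e he

/-- After a confirmed hypothesis nothing is left to learn, so the child `yes` may be terminal. -/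
theorem solves_equivalence {δ : Fin n → Bool} {no : Fin n → DecisionTree n}
    (h : ∀ i, (no i).Solves (restrict C (z i) (!(δ i))) z) :
    (equivalence δ (terminal δ) no).Solves C z := by
  intro c hc S σ hp hS
  cases hp with
  | yes _ _ _ S' _ h' =>
    cases h'
    funext i
    exact (hS (z i, δ i) (Or.inl ⟨i, rfl⟩)).symm
  | no _ _ _ i S' _ h' =>
    exact h i c ⟨hc, hS (z i, !(δ i)) (Or.inl rfl)⟩ S' σ h' fun e he => hS e (Or.inr he)

theorem depth_child_lt (i : Fin n) (child : Bool → DecisionTree n) (b : Bool) :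
    (child b).depth < (membership i child).depth := by
  simp only [depth]
  cases b <;> omega

theorem depth_no_lt (δ : Fin n → Bool) (yes : DecisionTree n) (no : Fin n → DecisionTree n)
    (i : Fin n) : (no i).depth < (equivalence δ yes no).depth := by
  have : (no i).depth ≤ Finset.univ.sup fun j => (no j).depth :=
    Finset.le_sup (f := fun j => (no j).depth) (Finset.mem_univ i)
  simp only [depth]
  omega

/-- One equivalence query about `δ`, if each counterexample leaves a family that `q` further
equivalence queries can deal with. -/
theorem exists_tree_succ {q : ℕ} (δ : Fin n → Bool)
    (h : ∀ i, ∃ Γ : DecisionTree n, Γ.OnlyEquivalence ∧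
      Γ.Solves (restrict C (z i) (!(δ i))) z ∧ Γ.depth ≤ q) :
    ∃ Γ : DecisionTree n, Γ.OnlyEquivalence ∧ Γ.Solves C z ∧ Γ.depth ≤ q + 1 := by
  choose no h1 h2 h3 using h
  refine ⟨.equivalence δ (.terminal δ) no, ⟨trivial, h1⟩, solves_equivalence h2, ?_⟩
  have : (Finset.univ.sup fun i => (no i).depth) ≤ q := Finset.sup_le fun i _ => h3 i
  simp only [depth]
  omega

end DecisionTree

/-! ### From problems to the functions `h2` and `h3` -/

section Bounds

variable {C : Set (Set U)} {n : ℕ}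

theorem hProblem3_le_hProblem2 (C : Set (Set U)) (z : Fin n → U) :
    hProblem3 C z ≤ hProblem2 C z := by
  obtain ⟨Γ, -, h2, h3⟩ := (isLeast_hProblem2 C z).1
  exact (isLeast_hProblem3 C z).2 ⟨Γ, h2, h3⟩

theorem h2_le [Nonempty U] {B : ℕ} (hn : 1 ≤ n)
    (h : ∀ m, m ≤ n → ∀ z : Fin m → U,
      ∃ Γ : DecisionTree m, Γ.OnlyEquivalence ∧ Γ.Solves C z ∧ Γ.depth ≤ B) :
    h2 C n ≤ B := by
  obtain ⟨m, -, hm, z, hz⟩ := (isGreatest_h2 C hn).1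
  obtain ⟨Γ, h1, h2, h3⟩ := h m hm z
  rw [← hz]
  exact ((isLeast_hProblem2 C z).2 ⟨Γ, h1, h2, rfl⟩).trans h3

theorem h3_le_h2 [Nonempty U] (hn : 1 ≤ n) : h3 C n ≤ h2 C n := by
  obtain ⟨m, hm1, hm, z, hz⟩ := (isGreatest_h3 C hn).1
  rw [← hz]
  exact (hProblem3_le_hProblem2 C z).trans ((isGreatest_h2 C hn).2 ⟨m, hm1, hm, z, rfl⟩)

theorem exists_tree_depth_le_h2 [Nonempty U] (hn : 1 ≤ n) (z : Fin n → U) :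
    ∃ Γ : DecisionTree n, Γ.OnlyEquivalence ∧ Γ.Solves C z ∧ Γ.depth ≤ h2 C n := by
  obtain ⟨Γ, h1, h2, h3⟩ := (isLeast_hProblem2 C z).1
  exact ⟨Γ, h1, h2, h3.trans_le ((isGreatest_h2 C hn).2 ⟨n, hn, le_rfl, z, rfl⟩)⟩

theorem exists_tree_depth_le_h3 [Nonempty U] (hn : 1 ≤ n) (z : Fin n → U) :
    ∃ Γ : DecisionTree n, Γ.Solves C z ∧ Γ.depth ≤ h3 C n := by
  obtain ⟨Γ, h2, h3⟩ := (isLeast_hProblem3 C z).1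
  exact ⟨Γ, h2, h3.trans_le ((isGreatest_h3 C hn).2 ⟨n, hn, le_rfl, z, rfl⟩)⟩

theorem exists_subset_range [Nonempty U] (Z : Finset U) (h : Z.card ≤ n) :
    ∃ z : Fin n → U, (Z : Set U) ⊆ Set.range z := by
  refine ⟨fun i => if hi : (i : ℕ) < Z.card then Z.equivFin.symm ⟨i, hi⟩
    else Classical.arbitrary U, fun u hu => ?_⟩
  refine ⟨⟨Z.equivFin ⟨u, hu⟩, (Z.equivFin ⟨u, hu⟩).isLt.trans_le h⟩, ?_⟩
  simp

end Bounds

/-! ### Upper bound for `k`-families -/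

theorem isKFamily_zero {C : Set (Set U)} :
    IsKFamily 0 C ↔ ∀ u : U, ∃ δ : Bool, ∀ c ∈ C, value u c = δ := by
  rw [IsKFamily]

theorem isKFamily_succ {k : ℕ} {C : Set (Set U)} :
    IsKFamily (k + 1) C ↔ (∀ m : Fin (k + 1), ¬ IsKFamily m.val C) ∧
      ∀ u : U, ∃ δ : Bool, ∃ m : Fin (k + 1), IsKFamily m.val (restrict C u δ) := by
  rw [IsKFamily]

theorem IsKFamily.exists_tree_depth_le {n : ℕ} (z : Fin n → U) (k : ℕ) :
    ∀ C : Set (Set U), IsKFamily k C →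
      ∃ Γ : DecisionTree n, Γ.OnlyEquivalence ∧ Γ.Solves C z ∧ Γ.depth ≤ k := by
  induction k using Nat.strong_induction_on with
  | _ k ih =>
    intro C hC
    cases k with
    | zero =>
      choose δ hδ using isKFamily_zero.1 hC
      refine ⟨.terminal fun i => δ (z i), trivial, DecisionTree.solves_terminal.2 ?_, le_rfl⟩
      intro c hc
      funext i
      exact (hδ (z i) c hc).symm
    | succ k =>
      choose δ m hm using (isKFamily_succ.1 hC).2
      refine DecisionTree.exists_tree_succ (fun i => !(δ (z i))) fun i => ?_
      obtain ⟨Γ, h1, h2, h3⟩ := ih (m (z i)).val (m (z i)).isLt _ (hm (z i))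
      refine ⟨Γ, h1, ?_, h3.trans (Nat.lt_succ_iff.1 (m (z i)).isLt)⟩
      simpa using h2

/-! ### Upper bound for families of finite VC-dimension -/

section Halving

variable {n : ℕ}

open Classical in
/-- The tuples `z(c)`, `c ∈ C`, each as the set of the `i` with `u_i(c) = 1`. -/
noncomputable def traces (C : Set (Set U)) (z : Fin n → U) : Finset (Finset (Fin n)) :=
  Finset.univ.filter fun s => ∃ c ∈ C, ∀ i, i ∈ s ↔ z i ∈ c

theorem mem_traces {C : Set (Set U)} {z : Fin n → U} {s : Finset (Fin n)} :
    s ∈ traces C z ↔ ∃ c ∈ C, ∀ i, i ∈ s ↔ z i ∈ c := by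
  simp [traces]

open Classical in
theorem filter_mem_traces {C : Set (Set U)} (z : Fin n → U) {c : Set U} (hc : c ∈ C) :
    (Finset.univ.filter fun i => z i ∈ c) ∈ traces C z :=
  mem_traces.2 ⟨c, hc, by simp⟩

theorem value_eq_true {u : U} {c : Set U} : value u c = true ↔ u ∈ c := by
  simp [value]

theorem value_eq_false {u : U} {c : Set U} : value u c = false ↔ u ∉ c := by
  simp [value]

theorem card_traces_restrict_add (C : Set (Set U)) (z : Fin n → U) (i : Fin n) :
    (traces (restrict C (z i) false) z).card + (traces (restrict C (z i) true) z).card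
      ≤ (traces C z).card := by
  classical
  rw [← Finset.card_union_of_disjoint]
  · refine Finset.card_le_card fun s hs => ?_
    rcases Finset.mem_union.1 hs with h | h <;> obtain ⟨c, hc, h⟩ := mem_traces.1 h <;>
      exact mem_traces.2 ⟨c, hc.1, h⟩
  · refine Finset.disjoint_left.2 fun s h0 h1 => ?_
    obtain ⟨c, hc, h⟩ := mem_traces.1 h0
    obtain ⟨c', hc', h'⟩ := mem_traces.1 h1
    exact value_eq_false.1 hc.2 ((h i).1 ((h' i).2 (value_eq_true.1 hc'.2)))

/-- The halving algorithm. -/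
theorem exists_tree_depth_le_of_card_lt (z : Fin n → U) (q : ℕ) :
    ∀ C : Set (Set U), (traces C z).card < 2 ^ (q + 1) →
      ∃ Γ : DecisionTree n, Γ.OnlyEquivalence ∧ Γ.Solves C z ∧ Γ.depth ≤ q := by
  induction q with
  | zero =>
    intro C hC
    have hle : (traces C z).card ≤ 1 := by simp at hC; omega
    have key : ∃ σ : Fin n → Bool, ∀ c ∈ C, σ = fun i => value (z i) c := by
      rcases C.eq_empty_or_nonempty with rfl | ⟨c, hc⟩
      · exact ⟨fun _ => false, by simp⟩
      · refine ⟨fun i => value (z i) c, fun c' hc' => funext fun i => ?_⟩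
        have h := Finset.card_le_one.1 hle _ (filter_mem_traces z hc) _ (filter_mem_traces z hc')
        have h' := Finset.ext_iff.1 h i
        simp only [Finset.mem_filter, Finset.mem_univ, true_and] at h'
        rwa [Bool.eq_iff_iff, value_eq_true, value_eq_true]
    obtain ⟨σ, hσ⟩ := key
    exact ⟨.terminal σ, trivial, DecisionTree.solves_terminal.2 hσ, le_rfl⟩
  | succ q ih =>
    intro C hC
    have hmaj : ∀ i, ∃ b : Bool, (traces (restrict C (z i) (!b)) z).card < 2 ^ (q + 1) := by
      intro i
      have h := card_traces_restrict_add C z i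
      rw [pow_succ] at hC
      by_cases h0 : (traces (restrict C (z i) false) z).card < 2 ^ (q + 1)
      · exact ⟨true, h0⟩
      · refine ⟨false, ?_⟩
        simp only [Bool.not_false]
        omega
    choose δ hδ using hmaj
    exact DecisionTree.exists_tree_succ δ fun i => ih _ (hδ i)

/-- Distinct indices in a shattered set of indices carry distinct elements, since some trace
separates them; so the VC-dimension of the traces is at most that of the family. -/
theorem exists_shattered_of_shatters {C : Set (Set U)} {z : Fin n → U} {s : Finset (Fin n)}
    (h : (traces C z).Shatters s) : ∃ A : Finset U, Shattered C A ∧ A.card = s.card := by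
  classical
  have hinj : Set.InjOn z s := by
    intro i hi j hj hij
    by_contra hne
    obtain ⟨t, ht, hst⟩ := h (Finset.singleton_subset_iff.2 hi)
    obtain ⟨c, -, hc⟩ := mem_traces.1 ht
    have h1 : i ∈ t := (Finset.mem_inter.1 (hst ▸ Finset.mem_singleton_self i)).2
    have h2 : j ∈ t := (hc j).2 (hij ▸ (hc i).1 h1)
    have h3 : j ∈ s ∩ t := Finset.mem_inter.2 ⟨hj, h2⟩
    rw [hst, Finset.mem_singleton] at h3
    exact hne h3.symm
  refine ⟨s.image z, fun X hX => ?_, Finset.card_image_of_injOn hinj⟩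
  obtain ⟨t, ht, hst⟩ := h (Finset.filter_subset (fun i => z i ∈ X) s)
  obtain ⟨c, hcC, hc⟩ := mem_traces.1 ht
  refine ⟨c, hcC, Set.ext fun u => ?_⟩
  have hmem : ∀ i ∈ s, (z i ∈ c ↔ z i ∈ X) := by
    intro i hi
    have := Finset.ext_iff.1 hst i
    simp only [Finset.mem_inter, Finset.mem_filter, hi, true_and] at this
    rw [← hc i, this]
  constructor
  · rintro ⟨hu, huc⟩
    obtain ⟨i, hi, rfl⟩ := Finset.mem_image.1 (Finset.mem_coe.1 hu)
    exact (hmem i hi).1 huc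
  · intro hu
    obtain ⟨i, hi, rfl⟩ := Finset.mem_image.1 (Finset.mem_coe.1 (hX hu))
    exact ⟨hX hu, (hmem i hi).2 hu⟩

theorem card_le_of_vcDim_le {C : Set (Set U)} {d : ℕ} (hd : vcDim C ≤ d) {A : Finset U}
    (hA : Shattered C A) : A.card ≤ d := by
  have h : ((A.card : ℕ) : ℕ∞) ≤ vcDim C :=
    le_iSup (fun A : {A : Finset U // Shattered C A} => (A.val.card : ℕ∞)) ⟨A, hA⟩
  exact_mod_cast h.trans hd

theorem card_traces_le {C : Set (Set U)} {d : ℕ} (hd : vcDim C ≤ d) (z : Fin n → U) {m : ℕ}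
    (hm : 1 ≤ m) (hnm : n ≤ m) : (traces C z).card ≤ (d + 1) * m ^ d := by
  classical
  have hvc : (traces C z).vcDim ≤ d := by
    refine Finset.sup_le fun s hs => ?_
    obtain ⟨A, hA, hcard⟩ := exists_shattered_of_shatters (Finset.mem_shatterer.1 hs)
    exact hcard ▸ card_le_of_vcDim_le hd hA
  calc (traces C z).card ≤ (traces C z).shatterer.card := Finset.card_le_card_shatterer _
    _ ≤ ∑ k ∈ Finset.Iic (traces C z).vcDim, (Fintype.card (Fin n)).choose k :=
      Finset.card_shatterer_le_sum_vcDim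
    _ ≤ ∑ k ∈ Finset.Iic d, (Fintype.card (Fin n)).choose k :=
      Finset.sum_le_sum_of_subset (Finset.Iic_subset_Iic.2 hvc)
    _ ≤ ∑ _k ∈ Finset.Iic d, m ^ d := by
      refine Finset.sum_le_sum fun k hk => ?_
      rw [Fintype.card_fin]
      exact (Nat.choose_le_pow n k).trans ((Nat.pow_le_pow_left hnm k).trans
        (Nat.pow_le_pow_right hm (Finset.mem_Iic.1 hk)))
    _ = (d + 1) * m ^ d := by simp

theorem h2_le_log [Nonempty U] {C : Set (Set U)} {d : ℕ} (hd : vcDim C ≤ d) (hn : 1 ≤ n) :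
    h2 C n ≤ Nat.log 2 ((d + 1) * n ^ d) :=
  h2_le hn fun _ hm z => exists_tree_depth_le_of_card_lt z _ C
    ((card_traces_le hd z hn hm).trans_lt (Nat.lt_pow_succ_log_self one_lt_two _))

end Halving

/-! ### Mistake trees -/

section MistakeTree

variable {n : ℕ} {z : Fin n → U}

/-- `C` has a mistake tree of depth `t` over the problem `z`: a complete binary tree of depth `t`
whose inner nodes are labeled with elements `z i` and whose leaves are reached by concepts of `C`.
The tree itself is not recorded; the recursion says that each of the two values of the label of the
root leaves a family with a mistake tree of depth one less. -/
def HasMistakeTree (z : Fin n → U) : ℕ → Set (Set U) → Prop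
  | 0, C => C.Nonempty
  | t + 1, C => ∃ i, ∀ b, HasMistakeTree z t (restrict C (z i) b)

theorem HasMistakeTree.nonempty {t : ℕ} :
    ∀ {C : Set (Set U)}, HasMistakeTree z t C → C.Nonempty := by
  induction t with
  | zero => exact fun h => h
  | succ t ih =>
    rintro C ⟨i, h⟩
    exact (ih (h true)).mono (restrict_subset C _ _)

/-- A family that is not an `m`-family for `m ≤ k` has a mistake tree of depth `k + 1`; as many
elements as the tree has inner nodes are enough to label it. -/
theorem exists_finset_hasMistakeTree (k : ℕ) :
    ∀ C : Set (Set U), (∀ m ≤ k, ¬ IsKFamily m C) →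
      ∃ Z : Finset U, Z.card < 2 ^ (k + 1) ∧
        ∀ (n : ℕ) (z : Fin n → U), (Z : Set U) ⊆ Set.range z → HasMistakeTree z (k + 1) C := by
  classical
  induction k with
  | zero =>
    intro C hC
    have h0 := hC 0 le_rfl
    rw [isKFamily_zero] at h0
    push Not at h0
    obtain ⟨u, hu⟩ := h0
    refine ⟨{u}, by simp, fun n z hz => ?_⟩
    obtain ⟨i, rfl⟩ := hz (Finset.mem_coe.2 (Finset.mem_singleton_self u))
    refine ⟨i, fun b => ?_⟩
    obtain ⟨c, hc, hb⟩ := hu (!b)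
    exact ⟨c, hc, by simpa using hb⟩
  | succ k ih =>
    intro C hC
    have h1 := hC (k + 1) le_rfl
    rw [isKFamily_succ] at h1
    have hlt : ∀ m : Fin (k + 1), ¬ IsKFamily m.val C := fun m => hC _ m.isLt.le
    have h2 : ∃ u : U, ∀ (δ : Bool) (m : Fin (k + 1)), ¬ IsKFamily m.val (restrict C u δ) := by
      by_contra hcon
      push Not at hcon
      exact h1 ⟨hlt, hcon⟩
    obtain ⟨u, hu⟩ := h2
    choose Z hZ hT using fun δ => ih (restrict C u δ) fun m hm => hu δ ⟨m, Nat.lt_succ_of_le hm⟩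
    refine ⟨insert u (Z false ∪ Z true), ?_, fun n z hz => ?_⟩
    · have e1 := Finset.card_insert_le u (Z false ∪ Z true)
      have e2 := Finset.card_union_le (Z false) (Z true)
      have e3 := hZ false
      have e4 := hZ true
      rw [pow_succ 2 (k + 1)]
      omega
    · obtain ⟨i, rfl⟩ := hz (Finset.mem_coe.2 (Finset.mem_insert_self u _))
      refine ⟨i, fun b => hT b n z fun v hv => hz ?_⟩
      have hv' : v ∈ Z b := hv
      cases b <;> simp [hv']

/-- The adversary for equivalence queries. It refutes a hypothesis at the root of the mistake tree,
and passes to the subtree for the value that it has announced. -/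
theorem HasMistakeTree.le_depth {t : ℕ} : ∀ {C : Set (Set U)}, HasMistakeTree z t C →
    ∀ Γ : DecisionTree n, Γ.OnlyEquivalence → Γ.Solves C z → t ≤ Γ.depth := by
  induction t with
  | zero => exact fun _ _ _ _ => Nat.zero_le _
  | succ t ih =>
    rintro C ⟨i, h⟩ Γ hE hS
    cases Γ with
    | terminal σ =>
      obtain ⟨c, hc⟩ := (h true).nonempty
      obtain ⟨c', hc'⟩ := (h false).nonempty
      rw [DecisionTree.solves_terminal] at hS
      have e := congrFun ((hS c hc.1).symm.trans (hS c' hc'.1)) i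
      simp only [hc.2, hc'.2] at e
      exact absurd e (by simp)
    | membership j child => exact hE.elim
    | equivalence δ yes no =>
      have := ih (h (!(δ i))) (no i) (hE.2 i) (hS.equivalence_no i)
      have := DecisionTree.depth_no_lt δ yes no i
      omega

/-- The leaves of a mistake tree of depth `t`. For a hypothesis `δ`, the set `T` is the branch along
which the values follow `δ`, and just one leaf agrees with `δ` on it. -/
theorem HasMistakeTree.exists_leaves {t : ℕ} : ∀ {C : Set (Set U)}, HasMistakeTree z t C →
    ∃ D : Finset (Set U), (D : Set (Set U)) ⊆ C ∧ D.card = 2 ^ t ∧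
      ∀ δ : Fin n → Bool, ∃ T : Finset (Fin n), T.card ≤ t ∧
        ∀ c ∈ D, ∀ c' ∈ D, (∀ i ∈ T, value (z i) c = δ i) → (∀ i ∈ T, value (z i) c' = δ i) →
          c = c' := by
  classical
  induction t with
  | zero =>
    rintro C ⟨c, hc⟩
    refine ⟨{c}, by simpa using hc, by simp, fun δ => ⟨∅, by simp, ?_⟩⟩
    simp
  | succ t ih =>
    rintro C ⟨i, h⟩
    choose D hDC hcard hT using fun b => ih (h b)
    have hval : ∀ b, ∀ c ∈ D b, value (z i) c = b := fun b c hc => (hDC b hc).2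
    have hmem : ∀ c ∈ D false ∪ D true, c ∈ D (value (z i) c) := by
      intro c hc
      rcases Finset.mem_union.1 hc with h | h <;> rwa [hval _ c h]
    refine ⟨D false ∪ D true, fun c hc => (hDC _ (hmem c hc)).1, ?_, fun δ => ?_⟩
    · rw [Finset.card_union_of_disjoint, hcard, hcard, pow_succ, mul_two]
      refine Finset.disjoint_left.2 fun c h0 h1 => ?_
      have := (hval _ c h0).symm.trans (hval _ c h1)
      simp at this
    · obtain ⟨T, hTc, hTD⟩ := hT (δ i) δ
      refine ⟨insert i T, (Finset.card_insert_le i T).trans (Nat.succ_le_succ hTc), ?_⟩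
      intro c hc c' hc' hδ hδ'
      have e := hmem c hc
      have e' := hmem c' hc'
      rw [hδ i (Finset.mem_insert_self i T)] at e
      rw [hδ' i (Finset.mem_insert_self i T)] at e'
      exact hTD c e c' e' (fun j hj => hδ j (Finset.mem_insert_of_mem hj))
        fun j hj => hδ' j (Finset.mem_insert_of_mem hj)

/-- The counting argument for trees with both kinds of queries: if each hypothesis can be refuted on
a set of at most `t` elements for all concepts but one, then a query splits the concepts into at
most `t + 1` parts that the tree still has to deal with, or into two. -/
theorem card_le_pow_depth {t : ℕ} (ht : 1 ≤ t) (Γ : DecisionTree n) :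
    ∀ D : Finset (Set U), Γ.Solves (D : Set (Set U)) z →
      (∀ δ : Fin n → Bool, ∃ T : Finset (Fin n), T.card ≤ t ∧
        ∀ c ∈ D, ∀ c' ∈ D, (∀ i ∈ T, value (z i) c = δ i) → (∀ i ∈ T, value (z i) c' = δ i) →
          c = c') →
      D.card ≤ (t + 1) ^ Γ.depth := by
  classical
  have hsub : ∀ (D : Finset (Set U)) (i : Fin n) (b : Bool),
      ((D.filter fun c => value (z i) c = b : Finset (Set U)) : Set (Set U))
        ⊆ restrict (D : Set (Set U)) (z i) b := by
    intro D i b c hc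
    simpa [restrict] using hc
  induction Γ with
  | terminal σ =>
    intro D hS hD
    rw [DecisionTree.solves_terminal] at hS
    obtain ⟨T, -, hT⟩ := hD σ
    simp only [DecisionTree.depth, pow_zero]
    refine Finset.card_le_one.2 fun c hc c' hc' => hT c hc c' hc' ?_ ?_
    · exact fun i _ => (congrFun (hS c hc) i).symm
    · exact fun i _ => (congrFun (hS c' hc') i).symm
  | membership i child ih =>
    intro D hS hD
    have hb : ∀ b, (D.filter fun c => value (z i) c = b).card
        ≤ (t + 1) ^ ((DecisionTree.membership i child).depth - 1) := by
      intro b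
      refine (ih b _ ((hS.membership_child b).mono (hsub D i b)) fun δ => ?_).trans ?_
      · obtain ⟨T, h1, h2⟩ := hD δ
        exact ⟨T, h1, fun c hc c' hc' =>
          h2 c (Finset.mem_filter.1 hc).1 c' (Finset.mem_filter.1 hc').1⟩
      · exact Nat.pow_le_pow_right (by omega)
          (Nat.le_sub_one_of_lt (DecisionTree.depth_child_lt i child b))
    have hcov : D ⊆ (D.filter fun c => value (z i) c = false) ∪
        (D.filter fun c => value (z i) c = true) := by
      intro c hc
      cases hv : value (z i) c <;> simp [hc, hv]
    have h1 := (Finset.card_le_card hcov).trans (Finset.card_union_le _ _)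
    have h2 := hb false
    have h3 := hb true
    have hpos := DecisionTree.depth_child_lt i child true
    rw [← Nat.sub_add_cancel (Nat.one_le_of_lt hpos), pow_succ]
    nlinarith [Nat.one_le_pow ((DecisionTree.membership i child).depth - 1) (t + 1) (by omega)]
  | equivalence δ yes no _ ih =>
    intro D hS hD
    set P := (t + 1) ^ ((DecisionTree.equivalence δ yes no).depth - 1) with hP
    have hP1 : 1 ≤ P := Nat.one_le_pow _ _ (by omega)
    have hb : ∀ i, (D.filter fun c => value (z i) c = !(δ i)).card ≤ P := by
      intro i
      refine (ih i _ ((hS.equivalence_no i).mono (hsub D i _)) fun δ' => ?_).trans ?_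
      · obtain ⟨T, h1, h2⟩ := hD δ'
        exact ⟨T, h1, fun c hc c' hc' =>
          h2 c (Finset.mem_filter.1 hc).1 c' (Finset.mem_filter.1 hc').1⟩
      · exact Nat.pow_le_pow_right (by omega)
          (Nat.le_sub_one_of_lt (DecisionTree.depth_no_lt δ yes no i))
    obtain ⟨T, hTc, hT⟩ := hD δ
    have hone : (D.filter fun c => ∀ i ∈ T, value (z i) c = δ i).card ≤ 1 := by
      refine Finset.card_le_one.2 fun c hc c' hc' => ?_
      rw [Finset.mem_filter] at hc hc'
      exact hT c hc.1 c' hc'.1 hc.2 hc'.2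
    have hcov : D ⊆ (D.filter fun c => ∀ i ∈ T, value (z i) c = δ i) ∪
        T.biUnion fun i => D.filter fun c => value (z i) c = !(δ i) := by
      intro c hc
      by_cases hall : ∀ i ∈ T, value (z i) c = δ i
      · exact Finset.mem_union_left _ (Finset.mem_filter.2 ⟨hc, hall⟩)
      · push Not at hall
        obtain ⟨i, hi, hne⟩ := hall
        refine Finset.mem_union_right _ (Finset.mem_biUnion.2 ⟨i, hi, ?_⟩)
        exact Finset.mem_filter.2 ⟨hc, Bool.eq_not.2 hne⟩
    have h1 := (Finset.card_le_card hcov).trans (Finset.card_union_le _ _)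
    have h2 := (Finset.card_biUnion_le_card_mul T _ P fun i _ => hb i).trans
      (Nat.mul_le_mul_right P hTc)
    have hdep : (DecisionTree.equivalence δ yes no).depth
        = (DecisionTree.equivalence δ yes no).depth - 1 + 1 := by
      simp [DecisionTree.depth]
    rw [hdep, pow_succ, ← hP]
    nlinarith

theorem HasMistakeTree.two_pow_le {t : ℕ} (ht : 1 ≤ t) {C : Set (Set U)}
    (h : HasMistakeTree z t C) (Γ : DecisionTree n) (hS : Γ.Solves C z) :
    2 ^ t ≤ (t + 1) ^ Γ.depth := by
  obtain ⟨D, hDC, hcard, hD⟩ := h.exists_leaves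
  exact hcard ▸ card_le_pow_depth ht Γ D (hS.mono hDC) hD

end MistakeTree

/-! ### Lower bounds outside the class of `k`-families -/

section LowerBounds

variable {C : Set (Set U)}

/-- A `0`-family has at most one concept, so an infinite family that is not in the class is not a
`k`-family for `k = 0` either. -/
theorem not_isKFamily (hC : C.Infinite) (h : ¬ InClassC C) (k : ℕ) : ¬ IsKFamily k C := by
  intro hk
  rcases Nat.eq_zero_or_pos k with rfl | hpos
  · choose δ hδ using isKFamily_zero.1 hk
    refine hC (Set.Subsingleton.finite fun c hc c' hc' => Set.ext fun u => ?_)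
    rw [← value_eq_true, ← value_eq_true, hδ u c hc, hδ u c' hc']
  · exact h ⟨k, hpos, hk⟩

theorem exists_hasMistakeTree [Nonempty U] (hC : C.Infinite) (h : ¬ InClassC C) {n t : ℕ}
    (ht : 1 ≤ t) (hn : 2 ^ t ≤ n) : ∃ z : Fin n → U, HasMistakeTree z t C := by
  obtain ⟨k, rfl⟩ := Nat.exists_eq_add_of_le' ht
  obtain ⟨Z, hZ, hT⟩ := exists_finset_hasMistakeTree k C fun m _ => not_isKFamily hC h m
  obtain ⟨z, hz⟩ := exists_subset_range Z (hZ.le.trans hn)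
  exact ⟨z, hT n z hz⟩

theorem log_le_h2 [Nonempty U] (hC : C.Infinite) (h : ¬ InClassC C) {n : ℕ} (hn : 2 ≤ n) :
    Nat.log 2 n ≤ h2 C n := by
  obtain ⟨z, hz⟩ := exists_hasMistakeTree hC h (Nat.log_pos one_lt_two hn)
    (Nat.pow_log_le_self 2 (by omega))
  obtain ⟨Γ, h1, h2, h3⟩ := exists_tree_depth_le_h2 (C := C) (by omega) z
  exact (hz.le_depth Γ h1 h2).trans h3

theorem two_pow_log_le [Nonempty U] (hC : C.Infinite) (h : ¬ InClassC C) {n : ℕ} (hn : 2 ≤ n) :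
    2 ^ Nat.log 2 n ≤ (Nat.log 2 n + 1) ^ h3 C n := by
  have ht : 1 ≤ Nat.log 2 n := Nat.log_pos one_lt_two hn
  obtain ⟨z, hz⟩ := exists_hasMistakeTree hC h ht (Nat.pow_log_le_self 2 (by omega))
  obtain ⟨Γ, h2, h3⟩ := exists_tree_depth_le_h3 (C := C) (by omega) z
  exact (hz.two_pow_le ht Γ h2).trans (Nat.pow_le_pow_right (by omega) h3)

end LowerBounds

/-! ### Infinite VC-dimension -/

section Shattering

variable {C : Set (Set U)} {n : ℕ}

/-- The adversary against both kinds of queries: as long as all tuples that continue the values `δ`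
on `K` are possible, an answer about an index outside `K` fixes one more value, and an answer about
an index in `K` fixes none. -/
theorem card_le_depth_add_card {z : Fin n → U} (Γ : DecisionTree n) :
    ∀ (D : Set (Set U)) (K : Finset (Fin n)) (δ : Fin n → Bool),
      (∀ τ : Fin n → Bool, (∀ i ∈ K, τ i = δ i) → ∃ c ∈ D, ∀ i, value (z i) c = τ i) →
      Γ.Solves D z → n ≤ Γ.depth + K.card := by
  have hstep : ∀ (D : Set (Set U)) (K : Finset (Fin n)) (δ : Fin n → Bool),
      (∀ τ : Fin n → Bool, (∀ i ∈ K, τ i = δ i) → ∃ c ∈ D, ∀ i, value (z i) c = τ i) →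
      ∀ i ∉ K, ∀ b : Bool, ∀ τ : Fin n → Bool,
        (∀ j ∈ insert i K, τ j = Function.update δ i b j) →
        ∃ c ∈ restrict D (z i) b, ∀ j, value (z j) c = τ j := by
    intro D K δ hD i hi b τ hτ
    obtain ⟨c, hc, hcτ⟩ := hD τ fun j hj => by
      rw [hτ j (Finset.mem_insert_of_mem hj), Function.update_of_ne (ne_of_mem_of_not_mem hj hi)]
    refine ⟨c, ⟨hc, ?_⟩, hcτ⟩
    rw [hcτ i, hτ i (Finset.mem_insert_self i K), Function.update_self]
  induction Γ with
  | terminal σ =>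
    intro D K δ hD hS
    rw [DecisionTree.solves_terminal] at hS
    have hK : K = Finset.univ := by
      by_contra hne
      obtain ⟨i, hi⟩ : ∃ i, i ∉ K := by
        by_contra hcon
        push Not at hcon
        exact hne (Finset.eq_univ_iff_forall.2 hcon)
      obtain ⟨c, hc, h1⟩ := hD (Function.update δ i (!(σ i))) fun j hj =>
        Function.update_of_ne (ne_of_mem_of_not_mem hj hi) _ _
      have h2 := congrFun (hS c hc) i
      have h3 := h1 i
      rw [Function.update_self] at h3
      simp only [h3] at h2
      simp at h2
    simp [hK]
  | membership i child ih =>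
    intro D K δ hD hS
    by_cases hi : i ∈ K
    · have h1 := ih (δ i) _ K δ (fun τ hτ => by
        obtain ⟨c, hc, hcτ⟩ := hD τ hτ
        exact ⟨c, ⟨hc, (hcτ i).trans (hτ i hi)⟩, hcτ⟩) (hS.membership_child (δ i))
      have := DecisionTree.depth_child_lt i child (δ i)
      omega
    · have h1 := ih true _ _ _ (hstep D K δ hD i hi true) (hS.membership_child true)
      have := DecisionTree.depth_child_lt i child true
      rw [Finset.card_insert_of_notMem hi] at h1
      omega
  | equivalence H yes no _ ih =>
    intro D K δ hD hS
    by_cases hK : ∃ i, i ∉ K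
    · obtain ⟨i, hi⟩ := hK
      have h1 := ih i _ _ _ (hstep D K δ hD i hi (!(H i))) (hS.equivalence_no i)
      have := DecisionTree.depth_no_lt H yes no i
      rw [Finset.card_insert_of_notMem hi] at h1
      omega
    · push Not at hK
      simp [Finset.eq_univ_iff_forall.2 hK]

theorem Shattered.mono {A B : Finset U} (h : Shattered C A) (hBA : B ⊆ A) : Shattered C B := by
  intro X hX
  obtain ⟨c, hc, hcX⟩ := h X (hX.trans (Finset.coe_subset.2 hBA))
  refine ⟨c, hc, Set.ext fun u => ⟨fun hu => ?_, fun hu => ?_⟩⟩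
  · exact hcX.subset ⟨Finset.coe_subset.2 hBA hu.1, hu.2⟩
  · exact ⟨hX hu, (hcX.superset hu).2⟩

theorem exists_shattered_card_eq (h : ¬ InClassD C) (n : ℕ) :
    ∃ A : Finset U, Shattered C A ∧ A.card = n := by
  have htop : vcDim C = ⊤ := not_lt_top_iff.1 h
  have hlt : (n : ℕ∞) < vcDim C := htop ▸ ENat.natCast_lt_top n
  obtain ⟨⟨A, hA⟩, hn⟩ := lt_iSup_iff.1 hlt
  obtain ⟨B, hBA, hB⟩ := Finset.exists_subset_card_eq (Nat.cast_lt.1 hn).le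
  exact ⟨B, hA.mono hBA, hB⟩

theorem le_h3 [Nonempty U] (h : ¬ InClassD C) (hn : 1 ≤ n) : n ≤ h3 C n := by
  obtain ⟨A, hA, hcard⟩ := exists_shattered_card_eq h n
  let e := A.equivFinOfCardEq hcard
  let z : Fin n → U := fun i => e.symm i
  obtain ⟨Γ, hS, hd⟩ := exists_tree_depth_le_h3 (C := C) hn z
  refine le_trans ?_ hd
  refine card_le_depth_add_card Γ C ∅ (fun _ => false) (fun τ _ => ?_) hS
  obtain ⟨c, hc, hcX⟩ := hA {u | ∃ i, z i = u ∧ τ i = true} (by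
    rintro _ ⟨i, rfl, -⟩
    exact (e.symm i).2)
  refine ⟨c, hc, fun i => ?_⟩
  rw [Bool.eq_iff_iff, value_eq_true]
  constructor
  · intro hi
    obtain ⟨j, hj, hτ⟩ := hcX.subset ⟨(e.symm i).2, hi⟩
    rwa [← e.symm.injective (Subtype.ext hj)]
  · intro hi
    exact (hcX.superset ⟨i, rfl, hi⟩).2

end Shattering

/-! ### Asymptotics -/

section Asymptotics

variable {C : Set (Set U)}

/-- A real form of `n < 2 ^ (Nat.log 2 n + 1)`. -/
theorem log_le_natLog_add_one_mul {n : ℕ} (hn : 1 ≤ n) :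
    Real.log n ≤ (Nat.log 2 n + 1 : ℝ) * Real.log 2 := by
  have h : (n : ℝ) ≤ 2 ^ (Nat.log 2 n + 1) := by
    exact_mod_cast (Nat.lt_pow_succ_log_self one_lt_two n).le
  have h' := Real.log_le_log (by exact_mod_cast hn) h
  rw [Real.log_pow] at h'
  exact_mod_cast h'

theorem log_two_bounds : 1 / 2 < Real.log 2 ∧ Real.log 2 < 1 :=
  ⟨by linarith [Real.log_two_gt_d9], by linarith [Real.log_two_lt_d9]⟩

/-- A real form of `2 ^ Nat.log 2 n ≤ n`. -/
theorem natLog_mul_le_log {n : ℕ} (hn : 1 ≤ n) :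
    (Nat.log 2 n : ℝ) * Real.log 2 ≤ Real.log n := by
  have h : (2 : ℝ) ^ Nat.log 2 n ≤ n := by
    exact_mod_cast Nat.pow_log_le_self 2 (by omega)
  have h' := Real.log_le_log (by positivity) h
  rwa [Real.log_pow] at h'

theorem isBigO_h2_log [Nonempty U] (hD : InClassD C) :
    (fun n : ℕ => (h2 C n : ℝ)) =O[atTop] (fun n : ℕ => Real.log (n : ℝ)) := by
  obtain ⟨d, hd⟩ := ENat.ne_top_iff_exists.1 hD.ne
  refine IsBigO.of_bound (2 * (Real.log (d + 1) + d)) ?_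
  filter_upwards [eventually_ge_atTop 3] with n hn
  have hn0 : (0 : ℝ) < n := by positivity
  have hlog : 1 ≤ Real.log n := by
    rw [Real.le_log_iff_exp_le hn0]
    have : (3 : ℝ) ≤ n := by exact_mod_cast hn
    linarith [Real.exp_one_lt_d9]
  have hpos : 1 ≤ (d + 1) * n ^ d := Nat.mul_pos (by omega) (by positivity)
  have h1 : (h2 C n : ℝ) ≤ Nat.log 2 ((d + 1) * n ^ d) := by
    exact_mod_cast h2_le_log hd.ge (by omega)
  have h2 := natLog_mul_le_log hpos
  have h3 : Real.log (((d + 1) * n ^ d : ℕ) : ℝ) = Real.log (d + 1) + d * Real.log n := by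
    push_cast
    rw [Real.log_mul (by positivity) (by positivity), Real.log_pow]
  have h4 : 0 ≤ Real.log ((d : ℝ) + 1) := Real.log_nonneg (by simp)
  rw [Real.norm_of_nonneg (by positivity), Real.norm_of_nonneg (by linarith)]
  have h5 : (Nat.log 2 ((d + 1) * n ^ d) : ℝ) * (1 / 2)
      ≤ Nat.log 2 ((d + 1) * n ^ d) * Real.log 2 :=
    mul_le_mul_of_nonneg_left log_two_bounds.1.le (by positivity)
  have h6 : Real.log ((d : ℝ) + 1) ≤ Real.log (d + 1) * Real.log n :=
    le_mul_of_one_le_right h4 hlog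
  rw [h3] at h2
  linarith

theorem isBigO_log_h2 [Nonempty U] (hC : C.Infinite) (h : ¬ InClassC C) :
    (fun n : ℕ => Real.log (n : ℝ)) =O[atTop] (fun n : ℕ => (h2 C n : ℝ)) := by
  refine IsBigO.of_bound 2 ?_
  filter_upwards [eventually_ge_atTop 2] with n hn
  have h1 : (1 : ℝ) ≤ Nat.log 2 n := by exact_mod_cast Nat.log_pos one_lt_two hn
  have h2 : (Nat.log 2 n : ℝ) ≤ h2 C n := by exact_mod_cast log_le_h2 hC h hn
  have h3 := log_le_natLog_add_one_mul (n := n) (by omega)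
  rw [Real.norm_of_nonneg (Real.log_natCast_nonneg n), Real.norm_of_nonneg (by positivity)]
  nlinarith [log_two_bounds.2]

theorem isBigO_log_div_h3 [Nonempty U] (hC : C.Infinite) (h : ¬ InClassC C) :
    (fun n : ℕ => Real.log (n : ℝ) / Real.log (Real.log (n : ℝ)))
      =O[atTop] (fun n : ℕ => (h3 C n : ℝ)) := by
  refine IsBigO.of_bound 4 ?_
  have hlim : Tendsto (fun n : ℕ => Real.log (n : ℝ)) atTop atTop :=
    Real.tendsto_log_atTop.comp tendsto_natCast_atTop_atTop
  filter_upwards [eventually_ge_atTop 2, hlim.eventually_ge_atTop 4] with n hn hlog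
  set t := Nat.log 2 n with ht
  set L := Real.log (n : ℝ) with hL
  have ht1 : (1 : ℝ) ≤ t := by exact_mod_cast Nat.log_pos one_lt_two hn
  have hLt : L ≤ ((t : ℝ) + 1) * Real.log 2 := log_le_natLog_add_one_mul (by omega)
  have htL : (t : ℝ) * Real.log 2 ≤ L := natLog_mul_le_log (by omega)
  have hloglog : 0 < Real.log L := Real.log_pos (by linarith)
  have hcount : (t : ℝ) * Real.log 2 ≤ h3 C n * Real.log (t + 1) := by
    have e : (2 : ℝ) ^ t ≤ ((t : ℝ) + 1) ^ h3 C n := by exact_mod_cast two_pow_log_le hC h hn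
    have e' := Real.log_le_log (by positivity) e
    rwa [Real.log_pow, Real.log_pow] at e'
  -- `t + 1 ≤ 2 L + 1 ≤ L ^ 2`
  have hsq : Real.log ((t : ℝ) + 1) ≤ 2 * Real.log L := by
    have e : (t : ℝ) + 1 ≤ L ^ 2 := by nlinarith [log_two_bounds.1]
    have e' := Real.log_le_log (by positivity) e
    rw [Real.log_pow] at e'
    exact_mod_cast e'
  have hhalf : L ≤ 2 * (t * Real.log 2) := by nlinarith [log_two_bounds.1]
  have hmul : (h3 C n : ℝ) * Real.log (t + 1) ≤ h3 C n * (2 * Real.log L) :=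
    mul_le_mul_of_nonneg_left hsq (by positivity)
  rw [Real.norm_of_nonneg (div_nonneg (by linarith) hloglog.le),
    Real.norm_of_nonneg (by positivity), div_le_iff₀ hloglog]
  linarith

theorem isBigO_h3_h2 [Nonempty U] :
    (fun n : ℕ => (h3 C n : ℝ)) =O[atTop] (fun n : ℕ => (h2 C n : ℝ)) := by
  refine IsBigO.of_bound 1 ?_
  filter_upwards [eventually_ge_atTop 1] with n hn
  have : (h3 C n : ℝ) ≤ h2 C n := by exact_mod_cast h3_le_h2 hn
  simpa using this

theorem isBigO_h2_one [Nonempty U] (h : InClassC C) :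
    (fun n : ℕ => (h2 C n : ℝ)) =O[atTop] (fun _ : ℕ => (1 : ℝ)) := by
  obtain ⟨k, -, hk⟩ := h
  refine IsBigO.of_bound k ?_
  filter_upwards [eventually_ge_atTop 1] with n hn
  have : (h2 C n : ℝ) ≤ k := by
    exact_mod_cast h2_le hn fun _ _ z => IsKFamily.exists_tree_depth_le z k C hk
  simpa using this

end Asymptotics

end ExactLearning

theorem theorem2 {U : Type*} [Infinite U] (C : Set (Set U)) (hC : C.Infinite) :
    (ExactLearning.InClassC C →
      (fun n : ℕ => (ExactLearning.h2 C n : ℝ)) =O[atTop] (fun _ : ℕ => (1 : ℝ)) ∧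
      (fun n : ℕ => (ExactLearning.h3 C n : ℝ)) =O[atTop] (fun _ : ℕ => (1 : ℝ))) ∧
    (ExactLearning.InClassD C ∧ ¬ ExactLearning.InClassC C →
      (fun n : ℕ => (ExactLearning.h2 C n : ℝ)) =Θ[atTop] (fun n : ℕ => Real.log (n : ℝ)) ∧
      (fun n : ℕ => Real.log (n : ℝ) / Real.log (Real.log (n : ℝ)))
        =O[atTop] (fun n : ℕ => (ExactLearning.h3 C n : ℝ)) ∧
      (fun n : ℕ => (ExactLearning.h3 C n : ℝ)) =O[atTop] (fun n : ℕ => Real.log (n : ℝ))) ∧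
    (¬ ExactLearning.InClassD C →
      ∀ n : ℕ, 1 ≤ n → ExactLearning.h2 C n = n ∧ ExactLearning.h3 C n = n) := by
  open ExactLearning in
  refine ⟨fun h => ⟨isBigO_h2_one h, isBigO_h3_h2.trans (isBigO_h2_one h)⟩, fun h => ?_,
    fun h n hn => ?_⟩
  · exact ⟨⟨isBigO_h2_log h.1, isBigO_log_h2 hC h.2⟩, isBigO_log_div_h3 hC h.2,
      isBigO_h3_h2.trans (isBigO_h2_log h.1)⟩
  · have h2n : h2 C n ≤ n := h2_le hn fun m hm z => by
      obtain ⟨Γ, h1, h2, h3⟩ := exists_tree C z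
      exact ⟨Γ, h1, h2, h3.trans hm⟩
    have h3n : n ≤ h3 C n := le_h3 h hn
    have h32 : h3 C n ≤ h2 C n := h3_le_h2 hn
    omega
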